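/- Let $m\in\mathbb N$ and $1\le p<\infty$, and let $\mathbb R^m$ carry the Euclidean metric. For a fuzzy set $u:\mathbb R^m\to[0,1]$ put $[u]_\alpha=\{x: u(x)\ge\alpha\}$ for $\alpha\in(0,1]$ and $[u]_0=\overline{\{x:u(x)>0\}}$. Let $F^1_{USCG}(\mathbb R^m)$ be the set of fuzzy sets $u$ in $\mathbb R^m$ such that $[u]_\alpha$ is nonempty and compact for every $\alpha\in(0,1]$. Let $H$ be the Hausdorff extended distance, let $$d_p(u,v)=\Big(\int_0^1 H([u]_\alpha,[v]_\alpha)^p\,d\alpha\Big)^{1/p},$$ and let $F^1_{USCG}(\mathbb R^m)^p$ be the set of $u\in F^1_{USCG}(\mathbb R^m)$ with $d_p(u,\widehat{x_0})<\infty$ for some (equivalently, every) point $x_0\in\mathbb R^m$, where $\widehat{x_0}$ is the indicator function of $\{x_0\}$; $d_p$ is a metric on this set. For $U\subseteq F^1_{USCG}(\mathbb R^m)^p$ and $\alpha\in[0,1]$ put $U(\alpha)=\bigcup_{u\in U}[u]_\alpha$. Call $U$ $p$-mean equi-left-continuous if for every $\varepsilon>0$ there is a $\delta\in(0,1]$ such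 that for all $u\in U$ and all $0\le h<\delta$, $$\Big(\int_h^1 H([u]_\alpha,[u]_{\alpha-h})^p\,d\alpha\Big)^{1/p}<\varepsilon .$$ Theorem. Let $U$ be a subset of $F^1_{USCG}(\mathbb R^m)^p$. 1. $U$ is relatively compact in $(F^1_{USCG}(\mathbb R^m)^p,d_p)$ (that is, its closure there is compact) if and only if (i) there exists an $h\in(0,1)$ such that $U(h)$ is bounded in $\mathbb R^m$, and (ii) $U$ is $p$-mean equi-left-continuous. 2. $U$ is totally bounded in $(F^1_{USCG}(\mathbb R^m)^p,d_p)$ if and only if (i) and (ii) hold. 3. $U$ is compact in $(F^1_{USCG}(\mathbb R^m)^p,d_p)$ if and only if (i) and (ii) hold and (iii) $U$ is closed in $(F^1_{USCG}(\mathbb R^m)^p,d_p)$. -/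

import Mathlib

open MeasureTheory Filter Topology
open scoped ENNReal

noncomputable section

namespace Fuzzy

/-- A fuzzy set in `X` is a function from `X` to the unit interval. -/
abbrev FuzzySet (X : Type*) := X → unitInterval

/-- The `α`-cut `[u]_α` of a fuzzy set: the upper level set `{x | α ≤ u x}` for `α > 0`, and the
support, i.e. the closure of `{x | 0 < u x}`, for `α = 0`. (Only `α ∈ [0,1]` is meaningful.) -/
def cut {X : Type*} [TopologicalSpace X] (u : FuzzySet X) (α : ℝ) : Set X :=
  if 0 < α then {x | α ≤ (u x : ℝ)} else closure {x | 0 < (u x : ℝ)}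

/-- Membership in `F¹_USCG(X)`: every cut `[u]_α` with `α ∈ (0,1]` is a nonempty compact set. -/
def IsUSCG1 {X : Type*} [TopologicalSpace X] (u : FuzzySet X) : Prop :=
  ∀ α ∈ Set.Ioc (0 : ℝ) 1, (cut u α).Nonempty ∧ IsCompact (cut u α)

/-- The fuzzy set `x̂`, the indicator function of the singleton `{x}`. -/
def pointFuzzy {X : Type*} (x : X) : FuzzySet X :=
  Set.indicator {x} (fun _ => 1)

/-- The extended distance `d_p(u,v) = (∫₀¹ H([u]_α,[v]_α)^p dα)^{1/p}`, with `H` the Hausdorff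
extended distance. -/
def fuzzyEDist {X : Type*} [PseudoEMetricSpace X] (p : ℝ) (u v : FuzzySet X) : ℝ≥0∞ :=
  (∫⁻ α in Set.Icc (0 : ℝ) 1, Metric.hausdorffEDist (cut u α) (cut v α) ^ p) ^ (1 / p)

/-- The space `F¹_USCG(X)^p` of the `u ∈ F¹_USCG(X)` with `d_p(u, x̂₀) < ∞` for some point `x₀`
(equivalently, for all points). -/
structure FuzzyUSCGp (X : Type*) [MetricSpace X] (p : ℝ) where
  toFuzzySet : FuzzySet X
  isUSCG1 : IsUSCG1 toFuzzySet
  exists_fuzzyEDist_lt_top : ∃ x₀ : X, fuzzyEDist p toFuzzySet (pointFuzzy x₀) < ∞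

section Basic

variable {X : Type*}

theorem cut_of_pos [TopologicalSpace X] (u : FuzzySet X) {α : ℝ} (h : 0 < α) :
    cut u α = {x | α ≤ (u x : ℝ)} := if_pos h

theorem isClosed_cut [MetricSpace X] {u : FuzzySet X} (hu : IsUSCG1 u) (α : ℝ) :
    IsClosed (cut u α) := by
  by_cases h0 : 0 < α
  · by_cases h1 : α ≤ 1
    · exact (hu α ⟨h0, h1⟩).2.isClosed
    · have : cut u α = ∅ := by
        rw [cut_of_pos u h0]
        ext x
        simp only [Set.mem_ofPred_eq, Set.mem_empty_iff_false, iff_false, not_le]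
        exact lt_of_le_of_lt (u x).2.2 (not_le.1 h1)
      rw [this]
      exact isClosed_empty
  · unfold cut
    rw [if_neg h0]
    exact isClosed_closure

theorem cut_pointFuzzy [MetricSpace X] (x : X) {α : ℝ} (h : α ∈ Set.Ioc (0 : ℝ) 1) :
    cut (pointFuzzy x) α = {x} := by
  rw [cut_of_pos _ h.1]
  ext y
  by_cases hy : y = x
  · simp [pointFuzzy, hy, h.2]
  · simp [pointFuzzy, hy, h.1]

theorem isUSCG1_pointFuzzy [MetricSpace X] (x : X) : IsUSCG1 (pointFuzzy x) := by
  intro α h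
  rw [cut_pointFuzzy x h]
  exact ⟨Set.singleton_nonempty x, isCompact_singleton⟩

/-- The cut-function is left continuous on `(0,1]` for the Hausdorff extended distance. -/
theorem tendsto_hausdorffEDist_cut [MetricSpace X] {u : FuzzySet X} (hu : IsUSCG1 u)
    {α : ℝ} (h : α ∈ Set.Ioc (0 : ℝ) 1) :
    Tendsto (fun β => Metric.hausdorffEDist (cut u β) (cut u α)) (𝓝[<] α) (𝓝 0) := by
  rw [ENNReal.tendsto_nhds_zero]
  intro ε hε
  have key : ∃ i : Set.Ioo (0 : ℝ) α, cut u i ⊆ {x | Metric.infEDist x (cut u α) < ε} := by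
    have : Nonempty (Set.Ioo (0 : ℝ) α) := ⟨⟨α / 2, by linarith [h.1], by linarith [h.1]⟩⟩
    refine exists_subset_nhds_of_isCompact (V := fun i : Set.Ioo (0 : ℝ) α => cut u i) ?_
      (fun i => (hu i ⟨i.2.1, i.2.2.le.trans h.2⟩).2) ?_
    · refine directed_of_isDirected_le (fun i j hij => ?_)
      change cut u j ⊆ cut u i
      rw [cut_of_pos u i.2.1, cut_of_pos u j.2.1]
      exact fun x hx => le_trans (show (i : ℝ) ≤ j from hij) hx
    · intro x hx
      have hxα : x ∈ cut u α := by
        rw [cut_of_pos u h.1]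
        change α ≤ (u x : ℝ)
        refine le_of_forall_lt_imp_le_of_dense (fun b hb => ?_)
        by_cases hb0 : 0 < b
        · have := Set.mem_iInter.1 hx ⟨b, hb0, hb⟩
          rwa [cut_of_pos u hb0] at this
        · exact (not_lt.1 hb0).trans (u x).2.1
      refine (isOpen_lt Metric.continuous_infEDist continuous_const).mem_nhds ?_
      change Metric.infEDist x (cut u α) < ε
      rwa [Metric.infEDist_zero_of_mem hxα]
  obtain ⟨i, hi⟩ := key
  filter_upwards [Ioo_mem_nhdsLT i.2.2] with β hβ
  have hβ0 : 0 < β := i.2.1.trans hβ.1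
  refine Metric.hausdorffEDist_le_of_infEDist (fun x hx => ?_) (fun x hx => ?_)
  · refine (hi ?_).le
    rw [cut_of_pos u hβ0] at hx
    rw [cut_of_pos u i.2.1]
    exact le_trans hβ.1.le hx
  · have : x ∈ cut u β := by
      rw [cut_of_pos u h.1] at hx
      rw [cut_of_pos u hβ0]
      exact le_trans hβ.2.le hx
    rw [Metric.infEDist_zero_of_mem this]
    exact zero_le

/-- `α ↦ H([u]_α,[v]_α)` is measurable on `[0,1]`, so that `d_p` is well defined. -/
theorem aemeasurable_hausdorffEDist_cut [MetricSpace X] {u v : FuzzySet X} (hu : IsUSCG1 u)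
    (hv : IsUSCG1 v) :
    AEMeasurable (fun α : ℝ => Metric.hausdorffEDist (cut u α) (cut v α))
      (volume.restrict (Set.Icc (0 : ℝ) 1)) := by
  rw [← restrict_Ioc_eq_restrict_Icc]
  let s : ℕ → ℝ → ℝ := fun n α => ((⌈α * (n + 1)⌉ : ℝ) - 1) / (n + 1)
  refine aemeasurable_of_tendsto_metrizable_ae' (f := fun n α =>
    Metric.hausdorffEDist (cut u (s n α)) (cut v (s n α))) (fun n => ?_) ?_
  · have h1 : Measurable (fun k : ℤ => Metric.hausdorffEDist (cut u (((k : ℝ) - 1) / (n + 1)))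
        (cut v (((k : ℝ) - 1) / (n + 1)))) := measurable_from_top
    exact (h1.comp (Int.measurable_ceil.comp (measurable_id.mul_const _))).aemeasurable
  · filter_upwards [ae_restrict_mem measurableSet_Ioc] with α hα
    have hs : Tendsto (fun n => s n α) atTop (𝓝[<] α) := by
      refine tendsto_nhdsWithin_iff.2 ⟨?_, Eventually.of_forall (fun n => ?_)⟩
      · have h1 : Tendsto (fun n : ℕ => α - 1 / ((n : ℝ) + 1)) atTop (𝓝 α) := by
          simpa using tendsto_const_nhds.sub (tendsto_one_div_add_atTop_nhds_zero_nat (𝕜 := ℝ))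
        refine tendsto_of_tendsto_of_tendsto_of_le_of_le h1 tendsto_const_nhds (fun n => ?_)
          (fun n => ?_)
        · have hn : (0 : ℝ) < n + 1 := by positivity
          change α - 1 / ((n : ℝ) + 1) ≤ ((⌈α * (n + 1)⌉ : ℝ) - 1) / (n + 1)
          rw [le_div_iff₀ hn, sub_mul, one_div, inv_mul_cancel₀ hn.ne']
          linarith [Int.le_ceil (α * ((n : ℝ) + 1))]
        · have hn : (0 : ℝ) < n + 1 := by positivity
          change ((⌈α * (n + 1)⌉ : ℝ) - 1) / (n + 1) ≤ α
          rw [div_le_iff₀ hn]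
          linarith [Int.ceil_lt_add_one (α * ((n : ℝ) + 1))]
      · have hn : (0 : ℝ) < n + 1 := by positivity
        change ((⌈α * (n + 1)⌉ : ℝ) - 1) / (n + 1) < α
        rw [div_lt_iff₀ hn]
        linarith [Int.ceil_lt_add_one (α * ((n : ℝ) + 1))]
    have lift : ∀ {w : FuzzySet X} (hw : IsUSCG1 w),
        Tendsto (fun n => (⟨cut w (s n α), isClosed_cut hw _⟩ : TopologicalSpace.Closeds X)) atTop
          (𝓝 ⟨cut w α, isClosed_cut hw _⟩) := by
      intro w hw
      rw [tendsto_iff_edist_tendsto_0]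
      exact (tendsto_hausdorffEDist_cut hw hα).comp hs
    exact (lift hu).edist (lift hv)

theorem fuzzyEDist_comm [MetricSpace X] (p : ℝ) (u v : FuzzySet X) :
    fuzzyEDist p u v = fuzzyEDist p v u := by
  simp only [fuzzyEDist, Metric.hausdorffEDist_comm]

theorem fuzzyEDist_self [MetricSpace X] {p : ℝ} (hp : 1 ≤ p) (u : FuzzySet X) :
    fuzzyEDist p u u = 0 := by
  have hp0 : 0 < p := by linarith
  simp [fuzzyEDist, Metric.hausdorffEDist_self, hp0]

theorem fuzzyEDist_triangle [MetricSpace X] {p : ℝ} (hp : 1 ≤ p) {u v w : FuzzySet X}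
    (hu : IsUSCG1 u) (hv : IsUSCG1 v) (hw : IsUSCG1 w) :
    fuzzyEDist p u w ≤ fuzzyEDist p u v + fuzzyEDist p v w := by
  have hp0 : 0 < p := by linarith
  refine le_trans ?_ (ENNReal.lintegral_Lp_add_le (aemeasurable_hausdorffEDist_cut hu hv)
    (aemeasurable_hausdorffEDist_cut hv hw) hp)
  refine ENNReal.rpow_le_rpow (lintegral_mono (fun α => ?_)) (by positivity)
  exact ENNReal.rpow_le_rpow Metric.hausdorffEDist_triangle hp0.le

theorem fuzzyEDist_pointFuzzy [MetricSpace X] {p : ℝ} (hp : 1 ≤ p) (x y : X) :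
    fuzzyEDist p (pointFuzzy x) (pointFuzzy y) = edist x y := by
  have hp0 : 0 < p := by linarith
  have h : ∫⁻ α in Set.Icc (0 : ℝ) 1,
      Metric.hausdorffEDist (cut (pointFuzzy x) α) (cut (pointFuzzy y) α) ^ p
        = ∫⁻ _ in Set.Ioc (0 : ℝ) 1, edist x y ^ p := by
    rw [← restrict_Ioc_eq_restrict_Icc]
    refine setLIntegral_congr_fun measurableSet_Ioc (fun α hα => ?_)
    simp only [cut_pointFuzzy _ hα, Metric.hausdorffEDist_singleton]
  rw [fuzzyEDist, h]
  simp [hp0.ne', ENNReal.rpow_rpow_inv]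

theorem eq_of_fuzzyEDist_eq_zero [MetricSpace X] {p : ℝ} (hp : 1 ≤ p) {u v : FuzzySet X}
    (hu : IsUSCG1 u) (hv : IsUSCG1 v) (h : fuzzyEDist p u v = 0) : u = v := by
  have hp0 : 0 < p := by linarith
  have h1 : ∫⁻ α in Set.Icc (0 : ℝ) 1, Metric.hausdorffEDist (cut u α) (cut v α) ^ p = 0 := by
    simpa [fuzzyEDist, ENNReal.rpow_eq_zero_iff, hp0, not_lt.2 hp0.le] using h
  have h2 : ∀ᵐ α ∂(volume.restrict (Set.Icc (0 : ℝ) 1)), cut u α = cut v α := by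
    rw [lintegral_eq_zero_iff' ((aemeasurable_hausdorffEDist_cut hu hv).pow_const p)] at h1
    filter_upwards [h1] with α hα
    have : Metric.hausdorffEDist (cut u α) (cut v α) = 0 := by
      simpa [ENNReal.rpow_eq_zero_iff, hp0, not_lt.2 hp0.le] using hα
    exact ((isClosed_cut hu α).hausdorffEDist_zero_iff (isClosed_cut hv α)).1 this
  have dense : ∀ a b : ℝ, 0 ≤ a → a < b → b ≤ 1 → ∃ α ∈ Set.Ioo a b, cut u α = cut v α := by
    intro a b ha hab hb
    have h3 : ∀ᵐ α ∂(volume.restrict (Set.Ioo a b)), cut u α = cut v α :=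
      ae_restrict_of_ae_restrict_of_subset
        (show Set.Ioo a b ⊆ Set.Icc (0 : ℝ) 1 from
          fun x hx => ⟨ha.trans hx.1.le, hx.2.le.trans hb⟩) h2
    have h4 := h3.and (ae_restrict_mem measurableSet_Ioo)
    have : NeBot (ae (volume.restrict (Set.Ioo a b))) := by
      rw [ae_neBot]
      intro h0
      have := Measure.restrict_eq_zero.1 h0
      simp at this
      linarith
    obtain ⟨α, hα⟩ := h4.exists
    exact ⟨α, hα.2, hα.1⟩
  have le : ∀ {u v : FuzzySet X}, (∀ a b : ℝ, 0 ≤ a → a < b → b ≤ 1 →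
      ∃ α ∈ Set.Ioo a b, cut u α = cut v α) → ∀ x, u x ≤ v x := by
    intro u v hd x
    by_contra hlt
    have hlt' : (v x : ℝ) < u x := not_le.1 hlt
    obtain ⟨α, hα, he⟩ := hd (v x) (u x) (v x).2.1 hlt' (u x).2.2
    have hα0 : 0 < α := lt_of_le_of_lt (v x).2.1 hα.1
    rw [cut_of_pos u hα0, cut_of_pos v hα0] at he
    have hx : x ∈ {y | α ≤ (v y : ℝ)} := he ▸ (show α ≤ (u x : ℝ) from hα.2.le)
    exact absurd hα.1 (not_lt.2 hx)
  funext x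
  refine le_antisymm (le dense x) (le (fun a b ha hab hb => ?_) x)
  obtain ⟨α, hα, he⟩ := dense a b ha hab hb
  exact ⟨α, hα, he.symm⟩

end Basic

/-- The metric `d_p` on `F¹_USCG(X)^p`, for `1 ≤ p < ∞`. -/
instance instMetricSpace (X : Type*) [MetricSpace X] (p : ℝ) [hp : Fact (1 ≤ p)] :
    MetricSpace (FuzzyUSCGp X p) :=
  letI : EMetricSpace (FuzzyUSCGp X p) :=
    { edist := fun u v => fuzzyEDist p u.toFuzzySet v.toFuzzySet
      edist_self := fun u => fuzzyEDist_self hp.out _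
      edist_comm := fun u v => fuzzyEDist_comm p _ _
      edist_triangle := fun u v w => fuzzyEDist_triangle hp.out u.isUSCG1 v.isUSCG1 w.isUSCG1
      eq_of_edist_eq_zero := by
        rintro ⟨u, hu, hu'⟩ ⟨v, hv, hv'⟩ h
        obtain rfl : u = v := eq_of_fuzzyEDist_eq_zero hp.out hu hv h
        rfl }
  EMetricSpace.toMetricSpace (by
    intro u v
    obtain ⟨x, hx⟩ := u.exists_fuzzyEDist_lt_top
    obtain ⟨y, hy⟩ := v.exists_fuzzyEDist_lt_top
    refine ne_top_of_le_ne_top (b := fuzzyEDist p u.toFuzzySet (pointFuzzy x) + (edist x y +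
      fuzzyEDist p v.toFuzzySet (pointFuzzy y))) ?_ ?_
    · exact ENNReal.add_ne_top.2 ⟨hx.ne, ENNReal.add_ne_top.2 ⟨edist_ne_top x y, hy.ne⟩⟩
    · rw [← fuzzyEDist_pointFuzzy hp.out x y, fuzzyEDist_comm p v.toFuzzySet]
      exact (fuzzyEDist_triangle hp.out u.isUSCG1 (isUSCG1_pointFuzzy x) v.isUSCG1).trans
        (add_le_add_right (fuzzyEDist_triangle hp.out (isUSCG1_pointFuzzy x)
          (isUSCG1_pointFuzzy y) v.isUSCG1) _))

theorem edist_def {X : Type*} [MetricSpace X] {p : ℝ} [Fact (1 ≤ p)] (u v : FuzzyUSCGp X p) :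
    edist u v = fuzzyEDist p u.toFuzzySet v.toFuzzySet := rfl

/-- `U(α) = ⋃_{u ∈ U} [u]_α`. -/
def cutUnion {X : Type*} [MetricSpace X] {p : ℝ} (U : Set (FuzzyUSCGp X p)) (α : ℝ) : Set X :=
  ⋃ u ∈ U, cut u.toFuzzySet α

/-- The quantity `(∫_h^1 H([u]_α,[u]_{α-h})^p dα)^{1/p}`. -/
def leftModulus {X : Type*} [PseudoEMetricSpace X] (p : ℝ) (u : FuzzySet X) (h : ℝ) : ℝ≥0∞ :=
  (∫⁻ α in Set.Icc h 1, Metric.hausdorffEDist (cut u α) (cut u (α - h)) ^ p) ^ (1 / p)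

/-- `U` is `p`-mean equi-left-continuous: for each `ε > 0` there is a `δ ∈ (0,1]`, the same for all
`u ∈ U`, such that `(∫_h^1 H([u]_α,[u]_{α-h})^p dα)^{1/p} < ε` for all `0 ≤ h < δ`. -/
def IsPMeanEquiLeftContinuous {X : Type*} [MetricSpace X] {p : ℝ}
    (U : Set (FuzzyUSCGp X p)) : Prop :=
  ∀ ε : ℝ, 0 < ε → ∃ δ ∈ Set.Ioc (0 : ℝ) 1, ∀ u ∈ U, ∀ h : ℝ, 0 ≤ h → h < δ →
    leftModulus p u.toFuzzySet h < ENNReal.ofReal ε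

end Fuzzy

end

/-! A fuzzy set in the space is an antitone curve `α ↦ [u]_α` in the hyperspace of compact sets, and
`d_p` is the `L^p` distance between such curves. The theorem is thus of Kolmogorov–Riesz type:
bounded values together with uniformly small translation error amount to total boundedness
(`totallyBounded_iff`). The statements on compactness follow because the space is complete
(`completeSpace_fuzzyUSCGp`).

Sufficiency: replace `u` by its rounding to the levels `i / N`. By monotonicity of cuts, the error
is at most the left modulus at `1 / N` plus the oscillation on a top strip of width `1 / N`, which
(i) controls. A rounded set is determined by `N` compact subsets of `U(1 / N)`. Equi-left-continuity
carries boundedness from `U(h)` down to `U(1 / N)`, so these subsets range over a totally bounded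
hyperspace.

Necessity: a point of `[u]_a` lies in every lower cut, so its distance to `x₀` is controlled by
`d_p(u, x̂₀)`. The left modulus of a single `u` tends to `0`, and it moves by at most `2 d_p(u, v)`
from `u` to `v`, so a finite net gives (ii).

Completeness: along a fast Cauchy sequence almost every cut converges; the limits are regularized
into a fuzzy set, and Fatou's lemma gives convergence in `d_p`. -/

noncomputable section

namespace Fuzzy


/-! ### Cuts, truncated shifts and roundings -/

section Cuts

variable {X : Type*}

theorem cut_anti [TopologicalSpace X] (u : FuzzySet X) {α β : ℝ} (h : α ≤ β) :
    cut u β ⊆ cut u α := by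
  unfold cut
  split_ifs with hb ha ha
  · exact fun x hx => h.trans hx
  · exact fun x hx => subset_closure (hb.trans_le hx : 0 < (u x : ℝ))
  · exact absurd (ha.trans_le h) hb
  · exact subset_rfl

/-- For nested sets only the distance from the larger to the smaller counts, and it grows when the
larger set is enlarged or the smaller one shrunk. Applied to cuts, this replaces any modulus of
continuity in `α`. -/
theorem hausdorffEDist_le_of_subset [PseudoEMetricSpace X] {s s' t' t : Set X} (h₁ : s ⊆ s')
    (h₂ : s' ⊆ t') (h₃ : t' ⊆ t) : Metric.hausdorffEDist s' t' ≤ Metric.hausdorffEDist s t := by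
  refine Metric.hausdorffEDist_le_of_infEDist (fun x hx => ?_) (fun x hx => ?_)
  · rw [Metric.infEDist_zero_of_mem (h₂ hx)]
    exact zero_le
  · rw [Metric.hausdorffEDist_comm]
    exact (Metric.infEDist_anti h₁).trans (Metric.infEDist_le_hausdorffEDist_of_mem (h₃ hx))

theorem hausdorffEDist_cut_mono [PseudoEMetricSpace X] (u : FuzzySet X) {a b c d : ℝ}
    (hab : a ≤ b) (hbc : b ≤ c) (hcd : c ≤ d) :
    Metric.hausdorffEDist (cut u c) (cut u b) ≤ Metric.hausdorffEDist (cut u d) (cut u a) :=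
  hausdorffEDist_le_of_subset (cut_anti u hcd) (cut_anti u hbc) (cut_anti u hab)

theorem IsUSCG1.nonempty_cut [TopologicalSpace X] {u : FuzzySet X} (hu : IsUSCG1 u) {α : ℝ}
    (h : α ≤ 1) : (cut u α).Nonempty :=
  (hu 1 ⟨one_pos, le_rfl⟩).1.mono (cut_anti u h)

theorem hausdorffEDist_cut_ne_top [MetricSpace X] {u v : FuzzySet X} (hu : IsUSCG1 u)
    (hv : IsUSCG1 v) {α β : ℝ} (hα : α ∈ Set.Ioc (0 : ℝ) 1) (hβ : β ∈ Set.Ioc (0 : ℝ) 1) :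
    Metric.hausdorffEDist (cut u α) (cut v β) ≠ ∞ :=
  Metric.hausdorffEDist_ne_top_of_nonempty_of_bounded (hu α hα).1 (hv β hβ).1
    (hu α hα).2.isBounded (hv β hβ).2.isBounded

/-- The cut `[u]_α`, `α ∈ (0,1]`, as a nonempty compact set. -/
def IsUSCG1.cutCompact [MetricSpace X] {u : FuzzySet X} (hu : IsUSCG1 u)
    (α : Set.Ioc (0 : ℝ) 1) : TopologicalSpace.NonemptyCompacts X :=
  ⟨⟨cut u α, (hu α α.2).2⟩, (hu α α.2).1⟩

/-- The fuzzy set whose `α`-cut is the `max t (α - h)`-cut of `u`. -/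
def shiftTrunc (u : FuzzySet X) (t h : ℝ) : FuzzySet X := fun x =>
  if t ≤ (u x : ℝ) then Set.projIcc 0 1 zero_le_one ((u x : ℝ) + h) else 0

theorem cut_shiftTrunc [TopologicalSpace X] (u : FuzzySet X) {t h α : ℝ} (ht : 0 < t)
    (hα : α ∈ Set.Ioc (0 : ℝ) 1) : cut (shiftTrunc u t h) α = cut u (max t (α - h)) := by
  rw [cut_of_pos _ hα.1, cut_of_pos _ (ht.trans_le (le_max_left _ _))]
  ext x
  have h1 : ¬ α ≤ 0 := not_le.2 hα.1
  by_cases hx : t ≤ (u x : ℝ)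
  · simp [shiftTrunc, hx, Set.coe_projIcc, h1, hα.2]
  · simp [shiftTrunc, hx, h1]

theorem IsUSCG1.shiftTrunc [TopologicalSpace X] {u : FuzzySet X} (hu : IsUSCG1 u) {t h : ℝ}
    (ht : t ∈ Set.Ioc (0 : ℝ) 1) (hh : 0 ≤ h) : IsUSCG1 (shiftTrunc u t h) := by
  intro α hα
  rw [cut_shiftTrunc u ht.1 hα]
  exact hu _ ⟨ht.1.trans_le (le_max_left _ _), max_le ht.2 (by linarith [hα.2])⟩

/-- The fuzzy set obtained by rounding the values of `u` down to multiples of `1 / N`. -/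
def discretize (N : ℕ) (u : FuzzySet X) : FuzzySet X := fun x =>
  Set.projIcc 0 1 zero_le_one (⌊N * (u x : ℝ)⌋ / N)

theorem cut_discretize [TopologicalSpace X] (u : FuzzySet X) {N : ℕ} (hN : 0 < N) {α : ℝ}
    (hα : α ∈ Set.Ioc (0 : ℝ) 1) : cut (discretize N u) α = cut u (⌈N * α⌉ / N) := by
  have hN' : (0 : ℝ) < N := by exact_mod_cast hN
  have h0 : (0 : ℝ) < ⌈N * α⌉ := by exact_mod_cast Int.ceil_pos.2 (mul_pos hN' hα.1)
  rw [cut_of_pos _ hα.1, cut_of_pos _ (by positivity)]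
  ext x
  have h1 : ¬ α ≤ 0 := not_le.2 hα.1
  simp only [discretize, Set.coe_projIcc, Set.mem_ofPred_eq, le_max_iff, h1, false_or, le_min_iff,
    hα.2, true_and, le_div_iff₀ hN', div_le_iff₀ hN']
  -- Both sides say `⌈N * α⌉ ≤ ⌊N * u x⌋`, by the Galois connections of ceiling and floor.
  rw [mul_comm α, ← Int.ceil_le, Int.le_floor, mul_comm (u x : ℝ)]

theorem ceil_mul_div_mem {N : ℕ} (hN : 0 < N) {α : ℝ} (hα : α ∈ Set.Ioc (0 : ℝ) 1) :
    (⌈N * α⌉ / N : ℝ) ∈ Set.Icc α 1 := by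
  have hN' : (0 : ℝ) < N := by exact_mod_cast hN
  refine ⟨?_, ?_⟩
  · rw [le_div_iff₀ hN', mul_comm]
    exact Int.le_ceil _
  · rw [div_le_one hN']
    have : ⌈N * α⌉ ≤ (N : ℤ) := Int.ceil_le.2 (by
      push_cast
      nlinarith [hα.2])
    exact_mod_cast this

theorem IsUSCG1.discretize [TopologicalSpace X] {u : FuzzySet X} (hu : IsUSCG1 u) {N : ℕ}
    (hN : 0 < N) : IsUSCG1 (discretize N u) := by
  intro α hα
  rw [cut_discretize u hN hα]
  exact hu _ ⟨hα.1.trans_le (ceil_mul_div_mem hN hα).1, (ceil_mul_div_mem hN hα).2⟩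

/-- The shifted cuts are those of `shiftTrunc u t h`, so measurability for pairs of fuzzy sets
applies. Truncating at `t > 0` avoids the levels `α ≤ h`, where the shifted level is not positive
and the cut may fail to be compact. -/
theorem aemeasurable_hausdorffEDist_cut_max_sub [MetricSpace X] {u : FuzzySet X} (hu : IsUSCG1 u)
    {t h : ℝ} (ht : t ∈ Set.Ioc (0 : ℝ) 1) (hh : 0 ≤ h) :
    AEMeasurable (fun α : ℝ => Metric.hausdorffEDist (cut u α) (cut u (max t (α - h))))
      (volume.restrict (Set.Icc (0 : ℝ) 1)) := by
  refine (aemeasurable_hausdorffEDist_cut hu (hu.shiftTrunc ht hh)).congr ?_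
  rw [← restrict_Ioc_eq_restrict_Icc]
  filter_upwards [ae_restrict_mem measurableSet_Ioc] with α hα
  rw [cut_shiftTrunc u ht.1 hα]

theorem aemeasurable_hausdorffEDist_cut_sub [MetricSpace X] {u : FuzzySet X} (hu : IsUSCG1 u)
    {h : ℝ} (hh : 0 ≤ h) :
    AEMeasurable (fun α : ℝ => Metric.hausdorffEDist (cut u α) (cut u (α - h)))
      (volume.restrict (Set.Icc h 1)) := by
  have hlim := tendsto_one_div_add_atTop_nhds_zero_nat (𝕜 := ℝ)
  refine aemeasurable_of_tendsto_metrizable_ae' (f := fun (n : ℕ) α =>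
    Metric.hausdorffEDist (cut u α) (cut u (max (1 / ((n : ℝ) + 1)) (α - h)))) (fun n => ?_) ?_
  · refine (aemeasurable_hausdorffEDist_cut_max_sub hu ⟨by positivity, ?_⟩ hh).mono_measure
      (Measure.restrict_mono (Set.Icc_subset_Icc_left hh) le_rfl)
    rw [div_le_one (by positivity)]
    linarith [n.cast_nonneg (α := ℝ)]
  · rw [← restrict_Ioc_eq_restrict_Icc]
    filter_upwards [ae_restrict_mem measurableSet_Ioc] with α hα
    -- For `α > h` the truncation is inactive once `1 / (n + 1) < α - h`.
    refine tendsto_const_nhds.congr' ?_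
    filter_upwards [hlim.eventually (gt_mem_nhds (sub_pos.2 hα.1))] with n hn
    rw [max_eq_right hn.le]

theorem measurePreserving_sub_restrict_Icc (a b h : ℝ) :
    MeasurePreserving (fun α : ℝ => α - h) (volume.restrict (Set.Icc (a + h) (b + h)))
      (volume.restrict (Set.Icc a b)) := by
  have := (measurePreserving_sub_right volume h).restrict_preimage
    (measurableSet_Icc (a := a) (b := b))
  rwa [Set.preimage_sub_const_Icc] at this

theorem setLIntegral_Icc_comp_sub (f : ℝ → ℝ≥0∞) (a b h : ℝ) :
    ∫⁻ α in Set.Icc (a + h) (b + h), f (α - h) = ∫⁻ α in Set.Icc a b, f α := by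
  have := (measurePreserving_sub_right volume h).setLIntegral_comp_preimage_emb
    (measurableEmbedding_subRight h) f (Set.Icc a b)
  rwa [Set.preimage_sub_const_Icc] at this

theorem fuzzyEDist_rpow [PseudoEMetricSpace X] {p : ℝ} (hp : 1 ≤ p) (u v : FuzzySet X) :
    fuzzyEDist p u v ^ p =
      ∫⁻ α in Set.Icc (0 : ℝ) 1, Metric.hausdorffEDist (cut u α) (cut v α) ^ p := by
  rw [fuzzyEDist, one_div, ENNReal.rpow_inv_rpow (by linarith)]

theorem leftModulus_rpow [PseudoEMetricSpace X] {p : ℝ} (hp : 1 ≤ p) (u : FuzzySet X) (h : ℝ) :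
    leftModulus p u h ^ p =
      ∫⁻ α in Set.Icc h 1, Metric.hausdorffEDist (cut u α) (cut u (α - h)) ^ p := by
  rw [leftModulus, one_div, ENNReal.rpow_inv_rpow (by linarith)]

end Cuts


/-! ### Completeness of the space -/

section Completeness

variable {X : Type*} [MetricSpace X]

/-- An antitone family of nonempty compact sets indexed by a dense set of levels agrees, up to
countably many levels, with the cuts of a fuzzy set. -/
theorem exists_isUSCG1_of_antitoneOn [SecondCountableTopology X] {A : Set ℝ}
    (hA : A ⊆ Set.Ioc 0 1)
    (hd : ∀ a b : ℝ, 0 ≤ a → a < b → b ≤ 1 → ∃ α ∈ A, α ∈ Set.Ioo a b) {K : ℝ → Set X}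
    (hK : ∀ α ∈ A, (K α).Nonempty ∧ IsCompact (K α))
    (hanti : ∀ α ∈ A, ∀ β ∈ A, α ≤ β → K β ⊆ K α) :
    ∃ u : FuzzySet X, IsUSCG1 u ∧ {α ∈ A | cut u α ≠ K α}.Countable := by
  -- The value `u x` is the supremum of the levels whose set contains `x`; inserting `0` keeps this
  -- supremum meaningful when there are none.
  let S : X → Set ℝ := fun x => insert 0 {α ∈ A | x ∈ K α}
  have hS1 : ∀ x, ∀ a ∈ S x, a ∈ Set.Icc (0 : ℝ) 1 := by
    rintro x a (rfl | ha)
    · exact ⟨le_rfl, zero_le_one⟩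
    · exact ⟨(hA ha.1).1.le, (hA ha.1).2⟩
  have hbdd : ∀ x, BddAbove (S x) := fun x => ⟨1, fun a ha => (hS1 x a ha).2⟩
  have hne : ∀ x, (S x).Nonempty := fun x => ⟨0, Set.mem_insert _ _⟩
  let u : FuzzySet X := fun x => ⟨sSup (S x), le_csSup (hbdd x) (Set.mem_insert _ _),
    csSup_le (hne x) fun a ha => (hS1 x a ha).2⟩
  have hcut : ∀ β ∈ Set.Ioc (0 : ℝ) 1, ∀ x, x ∈ cut u β ↔ ∀ α ∈ A, α < β → x ∈ K α := by
    intro β hβ x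
    rw [cut_of_pos u hβ.1]
    change β ≤ sSup (S x) ↔ _
    refine ⟨fun h α hα hαβ => ?_, fun h => ?_⟩
    · obtain ⟨γ, hγ, hαγ⟩ := exists_lt_of_lt_csSup (hne x) (hαβ.trans_le h)
      rcases hγ with rfl | hγ
      · exact absurd hαγ (not_lt.2 (hA hα).1.le)
      · exact hanti α hα γ hγ.1 hαγ.le hγ.2
    · by_contra hlt
      rw [not_le] at hlt
      obtain ⟨α, hα, hαI⟩ := hd (sSup (S x)) β (u x).2.1 hlt hβ.2
      exact absurd (le_csSup (hbdd x) (Set.mem_insert_of_mem 0 ⟨hα, h α hα hαI.2⟩))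
        (not_le.2 hαI.1)
  have hu : IsUSCG1 u := by
    intro β hβ
    obtain ⟨α₀, hα₀, hα₀β⟩ := hd 0 β le_rfl hβ.1 hβ.2
    have heq : cut u β = ⋂ α : {α // α ∈ A ∧ α < β}, K α := by
      ext x
      rw [hcut β hβ]
      simp only [Set.mem_iInter, Subtype.forall]
      exact ⟨fun h α hα => h α hα.1 hα.2, fun h α h1 h2 => h α ⟨h1, h2⟩⟩
    have hi : Nonempty {α // α ∈ A ∧ α < β} := ⟨⟨α₀, hα₀, hα₀β.2⟩⟩
    rw [heq]
    refine ⟨IsCompact.nonempty_iInter_of_directed_nonempty_isCompact_isClosed _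
      (directed_of_isDirected_le fun i j hij => hanti i i.2.1 j j.2.1 hij)
      (fun i => (hK i i.2.1).1) (fun i => (hK i i.2.1).2)
      (fun i => (hK i i.2.1).2.isClosed), ?_⟩
    exact (hK α₀ hα₀).2.of_isClosed_subset
      (isClosed_iInter fun i => (hK i i.2.1).2.isClosed)
      (Set.iInter_subset _ (⟨α₀, hα₀, hα₀β.2⟩ : {α // α ∈ A ∧ α < β}))
  refine ⟨u, hu, ?_⟩
  -- At an exceptional level some basic open `V α` meets `[u]_α` but misses `K α`. For exceptional
  -- `α < β`, the point of `V β` in `[u]_β` lies in `K α`, so `V α ≠ V β`; hence `V` injects these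
  -- levels into a countable basis.
  have hV : ∀ α ∈ {α ∈ A | cut u α ≠ K α}, ∃ V ∈ TopologicalSpace.countableBasis X,
      Disjoint V (K α) ∧ ∃ x ∈ V, x ∈ cut u α := by
    rintro α ⟨hα, hneq⟩
    have hsub : K α ⊆ cut u α := fun x hx =>
      (hcut α (hA hα) x).2 fun γ hγ hγα => hanti γ hγ α hα hγα.le hx
    obtain ⟨x, hx, hxK⟩ := Set.exists_of_ssubset (hsub.ssubset_of_ne (Ne.symm hneq))
    obtain ⟨V, hV, hxV, hVs⟩ := (TopologicalSpace.isBasis_countableBasis X).exists_subset_of_mem_open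
      (show x ∈ (K α)ᶜ from hxK) (hK α hα).2.isClosed.isOpen_compl
    exact ⟨V, hV, Set.disjoint_left.2 fun y hy => hVs hy, x, hxV, hx⟩
  choose! V hVb hVd x hxV hx using hV
  refine Set.countable_of_injective_of_countable_image (f := V) ?_
    ((TopologicalSpace.countable_countableBasis X).mono (by
      rintro _ ⟨α, hα, rfl⟩
      exact hVb α hα))
  have key : ∀ α ∈ {α ∈ A | cut u α ≠ K α}, ∀ β ∈ {α ∈ A | cut u α ≠ K α}, V α = V β → ¬ α < β := by
    intro α hα β hβ hαβ hlt
    exact Set.disjoint_left.1 (hVd α hα) (hαβ ▸ hxV β hβ)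
      ((hcut β (hA hβ.1) _).1 (hx β hβ) α hα.1 hlt)
  intro α hα β hβ hαβ
  exact le_antisymm (not_lt.1 (key β hβ α hα hαβ.symm)) (not_lt.1 (key α hα β hβ hαβ))

/-- `L^1` norms are dominated by `L^p` norms on a probability space; this allows summing distances
level by level. -/
theorem lintegral_hausdorffEDist_cut_le {p : ℝ} (hp : 1 ≤ p) {u v : FuzzySet X} (hu : IsUSCG1 u)
    (hv : IsUSCG1 v) :
    ∫⁻ α in Set.Icc (0 : ℝ) 1, Metric.hausdorffEDist (cut u α) (cut v α) ≤ fuzzyEDist p u v := by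
  have : IsProbabilityMeasure (volume.restrict (Set.Icc (0 : ℝ) 1)) := ⟨by simp⟩
  have := eLpNorm'_le_eLpNorm'_of_exponent_le one_pos hp (volume.restrict (Set.Icc (0 : ℝ) 1))
    (aemeasurable_hausdorffEDist_cut hu hv).aestronglyMeasurable
  simpa [eLpNorm', fuzzyEDist] using this

theorem exists_mem_Ioo_of_ae_restrict {P : ℝ → Prop}
    (h : ∀ᵐ α ∂(volume.restrict (Set.Icc (0 : ℝ) 1)), P α) {a b : ℝ} (ha : 0 ≤ a) (hab : a < b)
    (hb : b ≤ 1) : ∃ α, P α ∧ α ∈ Set.Ioo a b := by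
  have h3 : ∀ᵐ α ∂(volume.restrict (Set.Ioo a b)), P α :=
    ae_restrict_of_ae_restrict_of_subset
      (fun x hx => ⟨ha.trans hx.1.le, hx.2.le.trans hb⟩ : Set.Ioo a b ⊆ Set.Icc (0 : ℝ) 1) h
  have : NeBot (ae (volume.restrict (Set.Ioo a b))) := by
    rw [ae_neBot, Ne, Measure.restrict_eq_zero]
    simpa using hab
  exact (h3.and (ae_restrict_mem measurableSet_Ioo)).exists

theorem subset_of_tendsto_hausdorffEDist {s t : ℕ → Set X} {s' t' : Set X} (hst : ∀ n, s n ⊆ t n)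
    (hs : Tendsto (fun n => Metric.hausdorffEDist (s n) s') atTop (𝓝 0))
    (ht : Tendsto (fun n => Metric.hausdorffEDist (t n) t') atTop (𝓝 0)) (ht' : IsClosed t') :
    s' ⊆ t' := by
  intro x hx
  rw [Metric.mem_iff_infEDist_zero_of_closed ht']
  have h0 := hs.add ht
  rw [add_zero] at h0
  refine le_antisymm (ge_of_tendsto' h0 fun n => ?_) zero_le
  refine Metric.infEDist_le_infEDist_add_hausdorffEDist.trans (add_le_add_left ?_ _)
  refine (Metric.infEDist_anti (hst n)).trans ?_
  rw [Metric.hausdorffEDist_comm]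
  exact Metric.infEDist_le_hausdorffEDist_of_mem hx

theorem completeSpace_fuzzyUSCGp [CompleteSpace X] [SecondCountableTopology X] {p : ℝ}
    [hp : Fact (1 ≤ p)] : CompleteSpace (FuzzyUSCGp X p) := by
  have hp0 : 0 < p := one_pos.trans_le hp.out
  refine EMetric.complete_of_convergent_controlled_sequences (fun n => (2⁻¹ : ℝ≥0∞) ^ n)
    (fun n => ENNReal.pow_pos (by simp) n) fun w hw => ?_
  let u : ℕ → FuzzySet X := fun n => (w n).toFuzzySet
  have hu : ∀ n, IsUSCG1 (u n) := fun n => (w n).isUSCG1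
  have hd : ∀ N n m, N ≤ n → N ≤ m → fuzzyEDist p (u n) (u m) < 2⁻¹ ^ N := hw
  -- The levels at which the sequence of cuts has finite total length, hence converges in the
  -- complete hyperspace of nonempty compacts.
  let A : Set ℝ := {α | α ∈ Set.Ioc (0 : ℝ) 1 ∧
    ∑' n, Metric.hausdorffEDist (cut (u n) α) (cut (u (n + 1)) α) ≠ ∞}
  have hae : ∀ᵐ α ∂(volume.restrict (Set.Icc (0 : ℝ) 1)), α ∈ A := by
    have hfin : ∫⁻ α in Set.Icc (0 : ℝ) 1,
        ∑' n, Metric.hausdorffEDist (cut (u n) α) (cut (u (n + 1)) α) ≠ ∞ := by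
      rw [lintegral_tsum fun n => aemeasurable_hausdorffEDist_cut (hu n) (hu (n + 1))]
      refine ne_top_of_le_ne_top (b := ∑' n : ℕ, (2⁻¹ : ℝ≥0∞) ^ n) (by simp)
        (ENNReal.tsum_le_tsum fun n => ?_)
      exact (lintegral_hausdorffEDist_cut_le hp.out (hu n) (hu (n + 1))).trans
        (hd n n (n + 1) le_rfl n.le_succ).le
    have h1 := ae_lt_top' (AEMeasurable.tsum fun n =>
      aemeasurable_hausdorffEDist_cut (hu n) (hu (n + 1))) hfin
    have h2 : ∀ᵐ α ∂(volume.restrict (Set.Icc (0 : ℝ) 1)), α ∈ Set.Ioc (0 : ℝ) 1 := by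
      rw [← restrict_Ioc_eq_restrict_Icc]
      exact ae_restrict_mem measurableSet_Ioc
    filter_upwards [h1, h2] with α hα hα' using ⟨hα', hα.ne⟩
  have hlim : ∀ α ∈ A, ∃ K : TopologicalSpace.NonemptyCompacts X,
      Tendsto (fun n => Metric.hausdorffEDist (cut (u n) α) K) atTop (𝓝 0) := by
    rintro α ⟨hα, hsum⟩
    obtain ⟨K, hK⟩ := cauchySeq_tendsto_of_complete (cauchySeq_of_edist_le_of_tsum_ne_top
      (f := fun n => (hu n).cutCompact ⟨α, hα⟩) _ (fun n => le_rfl) hsum)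
    exact ⟨K, tendsto_iff_edist_tendsto_0.1 hK⟩
  have : Nonempty (TopologicalSpace.NonemptyCompacts X) :=
    ⟨(hu 0).cutCompact ⟨1, one_pos, le_rfl⟩⟩
  choose! K hK using hlim
  obtain ⟨v, hv, hvK⟩ := exists_isUSCG1_of_antitoneOn (A := A) (fun α hα => hα.1)
    (fun a b ha hab hb => exists_mem_Ioo_of_ae_restrict hae ha hab hb) (K := fun α => K α)
    (fun α _ => ⟨(K α).nonempty, (K α).isCompact⟩)
    (fun α hα β hβ hαβ => subset_of_tendsto_hausdorffEDist (fun n => cut_anti (u n) hαβ)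
      (hK β hβ) (hK α hα) (K α).isCompact.isClosed)
  have hconv : ∀ᵐ α ∂(volume.restrict (Set.Icc (0 : ℝ) 1)),
      Tendsto (fun n => Metric.hausdorffEDist (cut (u n) α) (cut v α)) atTop (𝓝 0) := by
    filter_upwards [hae, ae_restrict_of_ae (hvK.ae_notMem volume)] with α hα hα'
    have : cut v α = K α := by
      by_contra h
      exact hα' ⟨hα, h⟩
    rw [this]
    exact hK α hα
  have hdv : ∀ n, fuzzyEDist p (u n) v ≤ 2⁻¹ ^ n := by
    intro n
    rw [← ENNReal.rpow_le_rpow_iff hp0, fuzzyEDist_rpow hp.out]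
    -- Fatou's lemma in the second index.
    calc ∫⁻ α in Set.Icc (0 : ℝ) 1, Metric.hausdorffEDist (cut (u n) α) (cut v α) ^ p
        = ∫⁻ α in Set.Icc (0 : ℝ) 1,
          liminf (fun k => Metric.hausdorffEDist (cut (u n) α) (cut (u k) α) ^ p) atTop := by
          refine lintegral_congr_ae ?_
          filter_upwards [hconv, hae] with α hα hαA
          have h1 : Tendsto (fun k => (hu k).cutCompact ⟨α, hαA.1⟩) atTop
              (𝓝 (hv.cutCompact ⟨α, hαA.1⟩)) := tendsto_iff_edist_tendsto_0.2 hα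
          have h2 : Tendsto (fun k => Metric.hausdorffEDist (cut (u n) α) (cut (u k) α)) atTop
              (𝓝 (Metric.hausdorffEDist (cut (u n) α) (cut v α))) :=
            (tendsto_const_nhds (x := (hu n).cutCompact ⟨α, hαA.1⟩)).edist h1
          exact ((ENNReal.continuous_rpow_const.tendsto _).comp h2).liminf_eq.symm
      _ ≤ liminf (fun k => ∫⁻ α in Set.Icc (0 : ℝ) 1,
          Metric.hausdorffEDist (cut (u n) α) (cut (u k) α) ^ p) atTop :=
          lintegral_liminf_le' fun k => (aemeasurable_hausdorffEDist_cut (hu n) (hu k)).pow_const p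
      _ ≤ liminf (fun _ : ℕ => ((2⁻¹ : ℝ≥0∞) ^ n) ^ p) atTop := by
          refine liminf_le_liminf ?_
          filter_upwards [eventually_ge_atTop n] with k hk
          rw [← fuzzyEDist_rpow hp.out]
          exact ENNReal.rpow_le_rpow (hd n n k le_rfl hk).le hp0.le
      _ = (2⁻¹ ^ n) ^ p := liminf_const _
  obtain ⟨x₀, hx₀⟩ := (w 0).exists_fuzzyEDist_lt_top
  refine ⟨⟨v, hv, x₀, ?_⟩, ?_⟩
  · refine (fuzzyEDist_triangle hp.out hv (hu 0) (isUSCG1_pointFuzzy x₀)).trans_lt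
      (ENNReal.add_lt_top.2 ⟨?_, hx₀⟩)
    rw [fuzzyEDist_comm]
    exact (hdv 0).trans_lt (by simp)
  · rw [tendsto_iff_edist_tendsto_0]
    exact tendsto_of_tendsto_of_tendsto_of_le_of_le tendsto_const_nhds
      (ENNReal.tendsto_pow_atTop_nhds_zero_of_lt_one (by simp)) (fun _ => zero_le) hdv

end Completeness


/-! ### The left modulus, and necessity of the two conditions -/

section LeftModulus

variable {X : Type*} [MetricSpace X] {p : ℝ}

/-- Minkowski's inequality along `[u]_α, [v]_α, [v]_{α-h}, [u]_{α-h}`; translating by `h` turns the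
last term into part of `d_p(u, v)`. -/
theorem leftModulus_le_add (hp : 1 ≤ p) {u v : FuzzySet X} (hu : IsUSCG1 u) (hv : IsUSCG1 v)
    {h : ℝ} (hh : 0 ≤ h) :
    leftModulus p u h ≤ fuzzyEDist p u v + (leftModulus p v h + fuzzyEDist p u v) := by
  have hp0 : 0 < p := one_pos.trans_le hp
  have hsub : Set.Icc h 1 ⊆ Set.Icc (0 : ℝ) 1 := Set.Icc_subset_Icc_left hh
  have hI : Set.Icc h 1 = Set.Icc (0 + h) (1 - h + h) := by simp
  have hsub' : Set.Icc (0 : ℝ) (1 - h) ⊆ Set.Icc 0 1 := Set.Icc_subset_Icc_right (by linarith)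
  have hf := (aemeasurable_hausdorffEDist_cut hu hv).mono_measure
    (Measure.restrict_mono hsub le_rfl)
  have hg := aemeasurable_hausdorffEDist_cut_sub hv hh
  have hk : AEMeasurable (fun α => Metric.hausdorffEDist (cut v (α - h)) (cut u (α - h)))
      (volume.restrict (Set.Icc h 1)) := by
    rw [hI]
    exact ((aemeasurable_hausdorffEDist_cut hv hu).mono_measure
      (Measure.restrict_mono hsub' le_rfl)).comp_quasiMeasurePreserving
      (measurePreserving_sub_restrict_Icc 0 (1 - h) h).quasiMeasurePreserving
  have h1 : leftModulus p u h ≤ (∫⁻ α in Set.Icc h 1,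
      ((fun α => Metric.hausdorffEDist (cut u α) (cut v α)) +
        ((fun α => Metric.hausdorffEDist (cut v α) (cut v (α - h))) +
          fun α => Metric.hausdorffEDist (cut v (α - h)) (cut u (α - h)))) α ^ p) ^ (1 / p) := by
    refine ENNReal.rpow_le_rpow (lintegral_mono fun α => ?_) (by positivity)
    exact ENNReal.rpow_le_rpow (Metric.hausdorffEDist_triangle.trans
      (add_le_add_right Metric.hausdorffEDist_triangle _)) hp0.le
  refine h1.trans ((ENNReal.lintegral_Lp_add_le hf (hg.add hk) hp).trans (add_le_add ?_
    ((ENNReal.lintegral_Lp_add_le hg hk hp).trans (add_le_add le_rfl ?_))))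
  · exact ENNReal.rpow_le_rpow (lintegral_mono_set hsub) (by positivity)
  · rw [fuzzyEDist_comm]
    refine ENNReal.rpow_le_rpow ?_ (by positivity)
    rw [hI, setLIntegral_Icc_comp_sub
      (fun α => Metric.hausdorffEDist (cut v α) (cut u α) ^ p) 0 (1 - h) h]
    exact lintegral_mono_set hsub'

theorem leftModulus_zero (hp : 1 ≤ p) (u : FuzzySet X) : leftModulus p u 0 = 0 := by
  have hp0 : 0 < p := one_pos.trans_le hp
  simp [leftModulus, Metric.hausdorffEDist_self, hp0]

/-- Split at `α = t + h`. Below, enlarge `[u]_α`'s level to `1` and translate; above, `α - h > t`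
and the truncation does nothing. The first integral is small for small `t`, the second, for fixed
`t`, for small `h`. -/
theorem leftModulus_rpow_le (hp : 1 ≤ p) (u : FuzzySet X) {t h : ℝ} (hh : 0 ≤ h) :
    leftModulus p u h ^ p ≤
      (∫⁻ α in Set.Icc 0 t, Metric.hausdorffEDist (cut u 1) (cut u α) ^ p) +
        ∫⁻ α in Set.Ioc t 1, Metric.hausdorffEDist (cut u α) (cut u (max t (α - h))) ^ p := by
  have hp0 : 0 < p := one_pos.trans_le hp
  have hI : Set.Icc h 1 = (Set.Icc h 1 ∩ Set.Iic (t + h)) ∪ (Set.Icc h 1 ∩ Set.Ioi (t + h)) := by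
    rw [← Set.inter_union_distrib_left, Set.Iic_union_Ioi, Set.inter_univ]
  rw [leftModulus_rpow hp, hI]
  refine (lintegral_union_le _ _ _).trans (add_le_add ?_ ?_)
  · rw [← setLIntegral_Icc_comp_sub _ 0 t h]
    refine (setLIntegral_mono' (measurableSet_Icc.inter measurableSet_Iic) fun α hα =>
      ENNReal.rpow_le_rpow (hausdorffEDist_cut_mono u le_rfl (by linarith) hα.1.2) hp0.le).trans
      (lintegral_mono_set fun α hα => ⟨by linarith [hα.1.1], hα.2⟩)
  · calc _ = ∫⁻ α in Set.Icc h 1 ∩ Set.Ioi (t + h),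
          Metric.hausdorffEDist (cut u α) (cut u (max t (α - h))) ^ p := by
          refine setLIntegral_congr_fun (measurableSet_Icc.inter measurableSet_Ioi) fun α hα => ?_
          have : t + h < α := hα.2
          simp only [max_eq_right (by linarith : t ≤ α - h)]
      _ ≤ _ := lintegral_mono_set fun α hα => by
          have : t + h < α := hα.2
          exact ⟨by linarith, hα.1.2⟩

theorem lintegral_hausdorffEDist_cut_one_ne_top (hp : 1 ≤ p) {u : FuzzySet X} (hu : IsUSCG1 u)
    {x₀ : X} (hx₀ : fuzzyEDist p u (pointFuzzy x₀) < ∞) :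
    ∫⁻ α in Set.Icc (0 : ℝ) 1, Metric.hausdorffEDist (cut u 1) (cut u α) ^ p ≠ ∞ := by
  have hp0 : 0 < p := one_pos.trans_le hp
  have h1 : (1 : ℝ) ∈ Set.Ioc (0 : ℝ) 1 := ⟨one_pos, le_rfl⟩
  -- All cuts of `shiftTrunc u 1 0` at levels in `(0,1]` equal `[u]_1`, so the integral is the
  -- `p`-th power of a distance, finite by the triangle inequality through `x̂₀`.
  have hw : IsUSCG1 (shiftTrunc u 1 0) := hu.shiftTrunc h1 le_rfl
  have hcut : ∀ α ∈ Set.Ioc (0 : ℝ) 1, cut (shiftTrunc u 1 0) α = cut u 1 := fun α hα => by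
    rw [cut_shiftTrunc u one_pos hα, sub_zero, max_eq_left hα.2]
  have hfin : fuzzyEDist p (pointFuzzy x₀) (shiftTrunc u 1 0) ^ p ≠ ∞ := by
    rw [fuzzyEDist_rpow hp, ← restrict_Ioc_eq_restrict_Icc, setLIntegral_congr_fun
      (g := fun _ => Metric.hausdorffEDist {x₀} (cut u 1) ^ p) measurableSet_Ioc
      (fun α hα => by simp only [hcut α hα, cut_pointFuzzy x₀ hα])]
    have := hausdorffEDist_cut_ne_top (isUSCG1_pointFuzzy x₀) hu h1 h1
    rw [cut_pointFuzzy x₀ h1] at this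
    simp [this, hp0.le]
  have htri := fuzzyEDist_triangle hp hu (isUSCG1_pointFuzzy x₀) hw
  have hne : fuzzyEDist p u (shiftTrunc u 1 0) ^ p ≠ ∞ :=
    ENNReal.rpow_ne_top_of_nonneg hp0.le (ne_top_of_le_ne_top
      (ENNReal.add_ne_top.2 ⟨hx₀.ne, fun h => hfin (by rw [h, ENNReal.top_rpow_of_pos hp0])⟩) htri)
  rw [fuzzyEDist_comm, fuzzyEDist_rpow hp, ← restrict_Ioc_eq_restrict_Icc] at hne
  rw [← restrict_Ioc_eq_restrict_Icc]
  rwa [setLIntegral_congr_fun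
    (g := fun α => Metric.hausdorffEDist (cut u 1) (cut u α) ^ p) measurableSet_Ioc
    (fun α hα => by simp only [hcut α hα])] at hne

/-- Dominated convergence: left continuity of cuts gives the pointwise limit, and the constant
`H([u]_1,[u]_t)^p` is a finite bound because `t > 0`. -/
theorem tendsto_lintegral_hausdorffEDist_cut_max_sub (hp : 1 ≤ p) {u : FuzzySet X} (hu : IsUSCG1 u)
    {t : ℝ} (ht : t ∈ Set.Ioc (0 : ℝ) 1) :
    Tendsto (fun h => ∫⁻ α in Set.Ioc t 1,
      Metric.hausdorffEDist (cut u α) (cut u (max t (α - h))) ^ p) (𝓝[>] 0) (𝓝 0) := by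
  have hp0 : 0 < p := one_pos.trans_le hp
  refine tendsto_of_seq_tendsto fun h hh => ?_
  obtain ⟨hh0, hpos⟩ := tendsto_nhdsWithin_iff.1 hh
  obtain ⟨N, hN⟩ := eventually_atTop.1 hpos
  rw [← tendsto_add_atTop_iff_nat N]
  have hN' : ∀ n, 0 < h (n + N) := fun n => hN _ (Nat.le_add_left _ _)
  have hsub : Set.Ioc t 1 ⊆ Set.Icc (0 : ℝ) 1 := fun α hα => ⟨ht.1.le.trans hα.1.le, hα.2⟩
  have key := tendsto_lintegral_of_dominated_convergence' (μ := volume.restrict (Set.Ioc t 1))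
    (F := fun n α => Metric.hausdorffEDist (cut u α) (cut u (max t (α - h (n + N)))) ^ p)
    (f := fun _ => 0) (fun _ => Metric.hausdorffEDist (cut u 1) (cut u t) ^ p)
    (fun n => ((aemeasurable_hausdorffEDist_cut_max_sub hu ht (hN' n).le).mono_measure
      (Measure.restrict_mono hsub le_rfl)).pow_const p) (fun n => ?_) ?_ ?_
  · simpa using key
  · filter_upwards [ae_restrict_mem measurableSet_Ioc] with α hα
    exact ENNReal.rpow_le_rpow (hausdorffEDist_cut_mono u (le_max_left _ _)
      (max_le hα.1.le (by linarith [hN' n])) hα.2) hp0.le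
  · rw [lintegral_const]
    exact ENNReal.mul_ne_top (ENNReal.rpow_ne_top_of_nonneg hp0.le
      (hausdorffEDist_cut_ne_top hu hu ⟨one_pos, le_rfl⟩ ht)) (by simp)
  · filter_upwards [ae_restrict_mem measurableSet_Ioc] with α hα
    have h1 : Tendsto (fun n => max t (α - h (n + N))) atTop (𝓝[<] α) := by
      refine tendsto_nhdsWithin_iff.2 ⟨?_, Eventually.of_forall fun n =>
        max_lt hα.1 (by linarith [hN' n])⟩
      have := (tendsto_const_nhds (x := t)).max ((tendsto_const_nhds (x := α)).sub
        (hh0.comp (tendsto_add_atTop_nat N)))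
      rwa [sub_zero, max_eq_right hα.1.le] at this
    have h2 := (tendsto_hausdorffEDist_cut hu ⟨ht.1.trans hα.1, hα.2⟩).comp h1
    have h3 := (ENNReal.continuous_rpow_const (y := p)).continuousAt.tendsto.comp h2
    rw [ENNReal.zero_rpow_of_pos hp0] at h3
    refine h3.congr fun n => ?_
    simp only [Function.comp_apply, Metric.hausdorffEDist_comm]

theorem tendsto_leftModulus (hp : 1 ≤ p) {u : FuzzySet X} (hu : IsUSCG1 u)
    {x₀ : X} (hx₀ : fuzzyEDist p u (pointFuzzy x₀) < ∞) :
    Tendsto (leftModulus p u) (𝓝[>] 0) (𝓝 0) := by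
  have hp0 : 0 < p := one_pos.trans_le hp
  have hpow : Tendsto (fun h => leftModulus p u h ^ p) (𝓝[>] 0) (𝓝 0) := by
    rw [ENNReal.tendsto_nhds_zero]
    intro ε hε
    have hε2 : 0 < ε / 2 := ENNReal.half_pos hε.ne'
    have hs : Tendsto (volume.restrict (Set.Icc (0 : ℝ) 1) ∘ fun t => Set.Icc (0 : ℝ) t) (𝓝[>] 0)
        (𝓝 0) := by
      refine tendsto_of_tendsto_of_tendsto_of_le_of_le (h := fun t => ENNReal.ofReal t)
        tendsto_const_nhds ?_ (fun _ => zero_le) (fun t => ?_)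
      · have := (ENNReal.continuous_ofReal.tendsto 0).mono_left
          (nhdsWithin_le_nhds (s := Set.Ioi 0))
        rwa [ENNReal.ofReal_zero] at this
      · exact (Measure.restrict_apply_le _ _).trans (by simp)
    -- Absolute continuity of the integral fixes `t` before `h`.
    have hlim := tendsto_setLIntegral_zero (lintegral_hausdorffEDist_cut_one_ne_top hp hu hx₀) hs
    obtain ⟨t, ht, htI⟩ := ((ENNReal.tendsto_nhds_zero.1 hlim (ε / 2) hε2).and
      (Ioc_mem_nhdsGT (zero_lt_one' ℝ))).exists
    rw [Measure.restrict_restrict measurableSet_Icc,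
      Set.inter_eq_left.2 (Set.Icc_subset_Icc_right htI.2)] at ht
    filter_upwards [ENNReal.tendsto_nhds_zero.1
      (tendsto_lintegral_hausdorffEDist_cut_max_sub hp hu htI) (ε / 2) hε2,
      self_mem_nhdsWithin] with h hh hh0
    exact (leftModulus_rpow_le hp u (le_of_lt hh0)).trans
      ((add_le_add ht hh).trans (ENNReal.add_halves ε).le)
  have := (ENNReal.continuous_rpow_const (y := p⁻¹)).continuousAt.tendsto.comp hpow
  rw [ENNReal.zero_rpow_of_pos (inv_pos.2 hp0)] at this
  exact this.congr fun h => ENNReal.rpow_rpow_inv hp0.ne' _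

theorem _root_.TotallyBounded.isPMeanEquiLeftContinuous [hp : Fact (1 ≤ p)]
    {U : Set (FuzzyUSCGp X p)} (hU : TotallyBounded U) : IsPMeanEquiLeftContinuous U := by
  intro ε hε
  have hε3 : 0 < ENNReal.ofReal (ε / 3) := ENNReal.ofReal_pos.2 (by positivity)
  obtain ⟨s, hs, hUs⟩ := EMetric.totallyBounded_iff.1 hU _ hε3
  have hev : ∀ᶠ h in 𝓝[>] (0 : ℝ), ∀ v ∈ s,
      leftModulus p v.toFuzzySet h < ENNReal.ofReal (ε / 3) := by
    rw [eventually_all_finite hs]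
    intro v _
    obtain ⟨x₀, hx₀⟩ := v.exists_fuzzyEDist_lt_top
    exact (tendsto_leftModulus hp.out v.isUSCG1 hx₀).eventually (gt_mem_nhds hε3)
  obtain ⟨δ, hδ, hδs⟩ := (mem_nhdsGT_iff_exists_Ioo_subset).1 hev
  refine ⟨min δ 1, ⟨lt_min hδ one_pos, min_le_right _ _⟩, fun u hu h hh0 hhδ => ?_⟩
  rcases hh0.eq_or_lt with rfl | hh
  · rw [leftModulus_zero hp.out]
    exact ENNReal.ofReal_pos.2 hε
  · obtain ⟨v, hv, huv⟩ := Set.mem_iUnion₂.1 (hUs hu)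
    have huv' : fuzzyEDist p u.toFuzzySet v.toFuzzySet < ENNReal.ofReal (ε / 3) := huv
    refine (leftModulus_le_add hp.out u.isUSCG1 v.isUSCG1 hh0).trans_lt ?_
    refine (ENNReal.add_lt_add huv' (ENNReal.add_lt_add
      (hδs ⟨hh, hhδ.trans_le (min_le_left _ _)⟩ v hv) huv')).trans_le ?_
    rw [← ENNReal.ofReal_add (by positivity) (by positivity),
      ← ENNReal.ofReal_add (by positivity) (by positivity)]
    exact ENNReal.ofReal_le_ofReal (by linarith)

/-- Chebyshev's argument: `x` lies in every cut of level at most `a`, so the integrand is at least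
`edist x x₀ ^ p` on `(0, a]`. -/
theorem edist_rpow_mul_le_fuzzyEDist_rpow (hp : 1 ≤ p) (u : FuzzySet X) {a : ℝ} (ha : a ≤ 1)
    {x x₀ : X} (hx : x ∈ cut u a) :
    edist x x₀ ^ p * ENNReal.ofReal a ≤ fuzzyEDist p u (pointFuzzy x₀) ^ p := by
  have hp0 : 0 < p := one_pos.trans_le hp
  rw [fuzzyEDist_rpow hp, ← restrict_Ioc_eq_restrict_Icc]
  calc edist x x₀ ^ p * ENNReal.ofReal a = ∫⁻ _ in Set.Ioc 0 a, edist x x₀ ^ p := by simp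
    _ ≤ ∫⁻ α in Set.Ioc 0 a, Metric.hausdorffEDist (cut u α) (cut (pointFuzzy x₀) α) ^ p := by
      refine setLIntegral_mono' measurableSet_Ioc fun α hα => ENNReal.rpow_le_rpow ?_ hp0.le
      rw [cut_pointFuzzy x₀ ⟨hα.1, hα.2.trans ha⟩, ← Metric.infEDist_singleton]
      exact Metric.infEDist_le_hausdorffEDist_of_mem (cut_anti u hα.2 hx)
    _ ≤ _ := lintegral_mono_set (Set.Ioc_subset_Ioc_right ha)

theorem isBounded_cutUnion [hp : Fact (1 ≤ p)] {U : Set (FuzzyUSCGp X p)}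
    (hU : Bornology.IsBounded U) {a : ℝ} (ha : a ∈ Set.Ioc (0 : ℝ) 1) :
    Bornology.IsBounded (cutUnion U a) := by
  have hp0 : 0 < p := one_pos.trans_le hp.out
  rcases U.eq_empty_or_nonempty with rfl | ⟨v, hv⟩
  · simp [cutUnion]
  obtain ⟨x₀, hx₀⟩ := v.exists_fuzzyEDist_lt_top
  have hD : Metric.ediam U ≠ ∞ := Metric.isBounded_iff_ediam_ne_top.1 hU
  let M : ℝ≥0∞ := Metric.ediam U + fuzzyEDist p v.toFuzzySet (pointFuzzy x₀)
  have hM : M ≠ ∞ := ENNReal.add_ne_top.2 ⟨hD, hx₀.ne⟩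
  let R : ℝ≥0∞ := (M ^ p / ENNReal.ofReal a) ^ p⁻¹
  have ha0 : ENNReal.ofReal a ≠ 0 := (ENNReal.ofReal_pos.2 ha.1).ne'
  have hR : R ≠ ∞ := ENNReal.rpow_ne_top_of_nonneg (by positivity)
    (ENNReal.div_ne_top (ENNReal.rpow_ne_top_of_nonneg hp0.le hM) ha0)
  refine (Metric.isBounded_closedBall (x := x₀) (r := R.toReal)).subset fun x hx => ?_
  obtain ⟨u, hu, hxu⟩ := Set.mem_iUnion₂.1 hx
  have h1 : fuzzyEDist p u.toFuzzySet (pointFuzzy x₀) ≤ M :=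
    (fuzzyEDist_triangle hp.out u.isUSCG1 v.isUSCG1 (isUSCG1_pointFuzzy x₀)).trans
      (add_le_add_left (Metric.edist_le_ediam_of_mem hu hv) _)
  have h2 : edist x x₀ ≤ R := by
    rw [ENNReal.le_rpow_inv_iff hp0, ENNReal.le_div_iff_mul_le (Or.inl ha0) (Or.inl (by simp))]
    exact (edist_rpow_mul_le_fuzzyEDist_rpow hp.out _ ha.2 hxu).trans
      (ENNReal.rpow_le_rpow h1 hp0.le)
  rw [Metric.mem_closedBall, dist_edist]
  exact ENNReal.toReal_mono hR h2

end LeftModulus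


/-! ### Sufficiency by rounding to finitely many levels -/

section TotallyBounded

variable {X : Type*} [MetricSpace X] {p : ℝ}

theorem cutUnion_anti (U : Set (FuzzyUSCGp X p)) {a b : ℝ} (h : a ≤ b) :
    cutUnion U b ⊆ cutUnion U a :=
  Set.iUnion₂_mono fun u _ => cut_anti u.toFuzzySet h

/-- For `α ∈ [a, b + τ]` the interval `[α - τ, α]` contains `[b, a]`, so the integrand of the
modulus dominates `H([u]_a,[u]_b)^p` there. This turns an integral bound into one at individual
levels. -/
theorem hausdorffEDist_rpow_mul_le_leftModulus_rpow (hp : 1 ≤ p) (u : FuzzySet X) {a b τ : ℝ}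
    (hba : b ≤ a) (hτa : τ ≤ a) (hbτ : b + τ ≤ 1) :
    Metric.hausdorffEDist (cut u a) (cut u b) ^ p * ENNReal.ofReal (b + τ - a) ≤
      leftModulus p u τ ^ p := by
  have hp0 : 0 < p := one_pos.trans_le hp
  rw [leftModulus_rpow hp]
  calc _ = ∫⁻ _ in Set.Icc a (b + τ), Metric.hausdorffEDist (cut u a) (cut u b) ^ p := by simp
    _ ≤ ∫⁻ α in Set.Icc a (b + τ), Metric.hausdorffEDist (cut u α) (cut u (α - τ)) ^ p :=
      setLIntegral_mono' measurableSet_Icc fun α hα => ENNReal.rpow_le_rpow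
        (hausdorffEDist_cut_mono u (by linarith [hα.2]) hba hα.1) hp0.le
    _ ≤ _ := lintegral_mono_set (Set.Icc_subset_Icc hτa hbτ)

theorem isBounded_cutUnion_of_le_add [hp : Fact (1 ≤ p)] {U : Set (FuzzyUSCGp X p)} {a b τ : ℝ}
    (hU : ∀ u ∈ U, leftModulus p u.toFuzzySet τ ≤ 1)
    (hbd : Bornology.IsBounded (cutUnion U a)) (hτ : 0 < τ) (hba : b ≤ a) (hab : a ≤ b + τ / 2)
    (hτa : τ ≤ a) (hbτ : b + τ ≤ 1) : Bornology.IsBounded (cutUnion U b) := by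
  have hp0 : 0 < p := one_pos.trans_le hp.out
  have hτ0 : ENNReal.ofReal (τ / 2) ≠ 0 := (ENNReal.ofReal_pos.2 (by positivity)).ne'
  -- The window `[a, b + τ]` has length at least `τ / 2`, so `R` bounds `H([u]_a,[u]_b)` uniformly
  -- over `U`.
  let R : ℝ≥0∞ := (1 / ENNReal.ofReal (τ / 2)) ^ p⁻¹
  have hR : R ≠ ∞ := ENNReal.rpow_ne_top_of_nonneg (by positivity)
    (ENNReal.div_ne_top ENNReal.one_ne_top hτ0)
  refine (hbd.cthickening (δ := R.toReal)).subset fun x hx => ?_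
  obtain ⟨u, hu, hxu⟩ := Set.mem_iUnion₂.1 hx
  rw [Metric.mem_cthickening_iff, ENNReal.ofReal_toReal hR]
  have h1 : Metric.hausdorffEDist (cut u.toFuzzySet a) (cut u.toFuzzySet b) ≤ R := by
    rw [ENNReal.le_rpow_inv_iff hp0, ENNReal.le_div_iff_mul_le (Or.inl hτ0) (Or.inl (by simp))]
    calc _ ≤ Metric.hausdorffEDist (cut u.toFuzzySet a) (cut u.toFuzzySet b) ^ p *
          ENNReal.ofReal (b + τ - a) := by
          gcongr
          linarith
      _ ≤ leftModulus p u.toFuzzySet τ ^ p :=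
          hausdorffEDist_rpow_mul_le_leftModulus_rpow hp.out _ hba hτa hbτ
      _ ≤ 1 := ENNReal.rpow_le_one (hU u hu) hp0.le
  refine (Metric.infEDist_anti (Set.subset_biUnion_of_mem hu)).trans (le_trans ?_ h1)
  rw [Metric.hausdorffEDist_comm]
  exact Metric.infEDist_le_hausdorffEDist_of_mem hxu

/-- For a `p`-mean equi-left-continuous family, boundedness of the union of the cuts propagates
from one level to all positive levels. -/
theorem IsPMeanEquiLeftContinuous.isBounded_cutUnion [hp : Fact (1 ≤ p)]
    {U : Set (FuzzyUSCGp X p)} (hU : IsPMeanEquiLeftContinuous U) {a : ℝ}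
    (ha : a < 1) (hbd : Bornology.IsBounded (cutUnion U a)) {b : ℝ} (hb : 0 < b) :
    Bornology.IsBounded (cutUnion U b) := by
  obtain ⟨δ, hδ, hδU⟩ := hU 1 one_pos
  have hδ0 := hδ.1
  -- `τ < δ` bounds the modulus by `1`; `τ ≤ b` and `τ ≤ 1 - a` keep every averaging window inside
  -- `[τ, 1]` during the descent by steps of `τ / 2`.
  let τ := min (δ / 2) (min b (1 - a))
  have hτ : 0 < τ := lt_min (by linarith) (lt_min hb (by linarith))
  have hτδ : τ < δ := (min_le_left _ _).trans_lt (by linarith)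
  have hτb : τ ≤ b := (min_le_right _ _).trans (min_le_left _ _)
  have hτa : τ ≤ 1 - a := (min_le_right _ _).trans (min_le_right _ _)
  have hmod : ∀ u ∈ U, leftModulus p u.toFuzzySet τ ≤ 1 := fun u hu => by
    simpa using (hδU u hu τ hτ.le hτδ).le
  have key : ∀ n : ℕ, ∀ c, b ≤ c → a ≤ c + n * (τ / 2) →
      Bornology.IsBounded (cutUnion U c) := by
    intro n
    induction n with
    | zero => exact fun c _ hc => hbd.subset (cutUnion_anti U (by simpa using hc))
    | succ n ih =>
      intro c hbc hc
      push_cast at hc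
      rcases le_total a c with hac | hca
      · exact hbd.subset (cutUnion_anti U hac)
      · have hc' : c ≤ min a (c + τ / 2) := le_min hca (by linarith)
        have hn : 0 ≤ (n : ℝ) * (τ / 2) := by positivity
        refine isBounded_cutUnion_of_le_add hmod (ih (min a (c + τ / 2)) (hbc.trans hc') ?_) hτ
          hc' (min_le_right _ _) (by linarith) (by linarith)
        rcases min_cases a (c + τ / 2) with h | h <;> rw [h.1] <;> linarith
  obtain ⟨n, hn⟩ := exists_nat_ge ((a - b) / (τ / 2))
  refine key n b le_rfl ?_
  rw [div_le_iff₀ (by positivity)] at hn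
  linarith

/-- Rounding raises a level by at most `1 / N`. Up to level `1 - 1 / N` this is dominated by a full
shift by `1 / N`; on the remaining strip such a shift would leave `[0,1]`, and the whole oscillation
there is used. -/
theorem fuzzyEDist_discretize_le (hp : 1 ≤ p) (u : FuzzySet X) {N : ℕ} (hN : 0 < N) :
    fuzzyEDist p u (discretize N u) ≤ leftModulus p u (1 / N) +
      Metric.hausdorffEDist (cut u 1) (cut u (1 - 1 / N)) *
        ENNReal.ofReal (1 / N) ^ (1 / p) := by
  have hp0 : 0 < p := one_pos.trans_le hp
  have hN' : (0 : ℝ) < N := by exact_mod_cast hN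
  set h : ℝ := 1 / N with hh
  have hh0 : 0 < h := by positivity
  have hh1 : h ≤ 1 := by
    rw [hh, div_le_one hN']
    exact_mod_cast hN
  have hc : ∀ α : ℝ, (⌈N * α⌉ / N : ℝ) ≤ α + h := fun α => by
    rw [hh, div_le_iff₀ hN', add_mul, one_div, inv_mul_cancel₀ hN'.ne', mul_comm α]
    exact (Int.ceil_lt_add_one _).le
  have hU : Set.Ioc (0 : ℝ) 1 = Set.Ioc 0 (1 - h) ∪ Set.Ioc (1 - h) 1 :=
    (Set.Ioc_union_Ioc_eq_Ioc (by linarith) (by linarith)).symm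
  have h1 : ∫⁻ α in Set.Ioc 0 (1 - h),
      Metric.hausdorffEDist (cut u α) (cut (discretize N u) α) ^ p ≤ leftModulus p u h ^ p := by
    rw [leftModulus_rpow hp]
    calc _ ≤ ∫⁻ α in Set.Ioc 0 (1 - h),
          Metric.hausdorffEDist (cut u (α + h)) (cut u α) ^ p := by
          refine setLIntegral_mono' measurableSet_Ioc fun α hα => ENNReal.rpow_le_rpow ?_ hp0.le
          have hα1 : α ∈ Set.Ioc (0 : ℝ) 1 := ⟨hα.1, by linarith [hα.2]⟩
          rw [cut_discretize u hN hα1, Metric.hausdorffEDist_comm]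
          exact hausdorffEDist_cut_mono u le_rfl (ceil_mul_div_mem hN hα1).1 (hc α)
      _ ≤ ∫⁻ α in Set.Icc 0 (1 - h), Metric.hausdorffEDist (cut u (α + h)) (cut u α) ^ p :=
          lintegral_mono_set Set.Ioc_subset_Icc_self
      _ = _ := by
          rw [← setLIntegral_Icc_comp_sub _ 0 (1 - h) h]
          simp
  have h2 : ∫⁻ α in Set.Ioc (1 - h) 1,
      Metric.hausdorffEDist (cut u α) (cut (discretize N u) α) ^ p ≤
      Metric.hausdorffEDist (cut u 1) (cut u (1 - h)) ^ p * ENNReal.ofReal h := by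
    calc _ ≤ ∫⁻ _ in Set.Ioc (1 - h) 1,
          Metric.hausdorffEDist (cut u 1) (cut u (1 - h)) ^ p := by
          refine setLIntegral_mono' measurableSet_Ioc fun α hα => ENNReal.rpow_le_rpow ?_ hp0.le
          have hα1 : α ∈ Set.Ioc (0 : ℝ) 1 := ⟨by linarith [hα.1], hα.2⟩
          rw [cut_discretize u hN hα1, Metric.hausdorffEDist_comm]
          exact hausdorffEDist_cut_mono u hα.1.le (ceil_mul_div_mem hN hα1).1
            (ceil_mul_div_mem hN hα1).2
      _ = _ := by simp
  rw [fuzzyEDist, ← restrict_Ioc_eq_restrict_Icc, hU]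
  have hp1 : 1 / p ≤ 1 := by rwa [div_le_one hp0]
  refine (ENNReal.rpow_le_rpow ((lintegral_union_le _ _ _).trans (add_le_add h1 h2))
    (by positivity)).trans ((ENNReal.rpow_add_le_add_rpow _ _ (by positivity) hp1).trans ?_)
  rw [ENNReal.mul_rpow_of_nonneg _ _ (by positivity), one_div, ENNReal.rpow_rpow_inv hp0.ne',
    ENNReal.rpow_rpow_inv hp0.ne']

theorem fuzzyEDist_discretize_discretize_le (hp : 1 ≤ p) (u v : FuzzySet X) {N : ℕ} (hN : 0 < N)
    {r : ℝ≥0∞} (h : ∀ i : Fin N, Metric.hausdorffEDist (cut u ((i + 1) / N))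
      (cut v ((i + 1) / N)) ≤ r) :
    fuzzyEDist p (discretize N u) (discretize N v) ≤ r := by
  have hp0 : 0 < p := one_pos.trans_le hp
  have hN' : (0 : ℝ) < N := by exact_mod_cast hN
  rw [← ENNReal.rpow_le_rpow_iff hp0, fuzzyEDist_rpow hp, ← restrict_Ioc_eq_restrict_Icc]
  calc _ ≤ ∫⁻ _ in Set.Ioc (0 : ℝ) 1, r ^ p := by
        refine setLIntegral_mono' measurableSet_Ioc fun α hα => ENNReal.rpow_le_rpow ?_ hp0.le
        rw [cut_discretize u hN hα, cut_discretize v hN hα]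
        have h0 : 0 < ⌈N * α⌉ := Int.ceil_pos.2 (mul_pos hN' hα.1)
        have h1 : ⌈N * α⌉ ≤ (N : ℤ) := Int.ceil_le.2 (by
          push_cast
          nlinarith [hα.2])
        -- `⌈N * α⌉` runs over `1, …, N`, whence the index `⌈N * α⌉ - 1` in `Fin N`.
        have h2 : (⌈N * α⌉ : ℝ) = ((⌈N * α⌉ - 1).toNat : ℝ) + 1 := by
          have : ⌈N * α⌉ = ((⌈N * α⌉ - 1).toNat : ℤ) + 1 := by omega
          exact_mod_cast this
        rw [h2]
        exact h ⟨(⌈N * α⌉ - 1).toNat, by omega⟩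
    _ = r ^ p := by simp

theorem IsPMeanEquiLeftContinuous.totallyBounded [ProperSpace X] [hp : Fact (1 ≤ p)]
    {U : Set (FuzzyUSCGp X p)} (hU : IsPMeanEquiLeftContinuous U) {a : ℝ}
    (ha : a < 1) (hbd : Bornology.IsBounded (cutUnion U a)) : TotallyBounded U := by
  have hp0 : 0 < p := one_pos.trans_le hp.out
  refine Metric.totallyBounded_of_finite_discretization fun ε hε => ?_
  -- Each of the two roundings costs less than `2e`, and comparing the rounded sets costs at most
  -- `e`.
  let e : ℝ≥0∞ := ENNReal.ofReal (ε / 5)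
  have he : 0 < e := ENNReal.ofReal_pos.2 (by positivity)
  obtain ⟨δ, hδ, hδU⟩ := hU (ε / 5) (by positivity)
  let D := Metric.ediam (cutUnion U a)
  have hD : D ≠ ∞ := Metric.isBounded_iff_ediam_ne_top.1 hbd
  have hlim : Tendsto (fun n : ℕ => (1 / n : ℝ)) atTop (𝓝 0) := tendsto_one_div_atTop_nhds_zero_nat
  have hlimD : Tendsto (fun n : ℕ => D * ENNReal.ofReal (1 / n) ^ (1 / p)) atTop (𝓝 0) := by
    have h1 := (ENNReal.continuous_rpow_const (y := 1 / p)).continuousAt.tendsto.comp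
      (ENNReal.tendsto_ofReal hlim)
    rw [ENNReal.ofReal_zero, ENNReal.zero_rpow_of_pos (by positivity)] at h1
    have h2 := ENNReal.Tendsto.const_mul h1 (Or.inr hD)
    rwa [mul_zero] at h2
  -- `1 / N < 1 - a` puts the top strip above level `a`, so its oscillation is at most the diameter
  -- `D` of `U(a)`.
  obtain ⟨N, hNδ, hNa, hND, hN⟩ := ((hlim.eventually (gt_mem_nhds hδ.1)).and
    ((hlim.eventually (gt_mem_nhds (sub_pos.2 ha))).and
    ((ENNReal.tendsto_nhds_zero.1 hlimD e he).and (eventually_gt_atTop 0)))).exists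
  have hN' : (0 : ℝ) < N := by exact_mod_cast hN
  have happ : ∀ u ∈ U, fuzzyEDist p u.toFuzzySet (discretize N u.toFuzzySet) < e + e := by
    intro u hu
    have hle : Metric.hausdorffEDist (cut u.toFuzzySet 1) (cut u.toFuzzySet (1 - 1 / N)) *
        ENNReal.ofReal (1 / N) ^ (1 / p) ≤ e := by
      refine le_trans (mul_le_mul_left ?_ _) hND
      refine (Metric.hausdorffEDist_le_ediam (u.isUSCG1.nonempty_cut le_rfl)
        (u.isUSCG1.nonempty_cut (sub_le_self _ (by positivity)))).trans (Metric.ediam_mono ?_)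
      have hsub : ∀ b, a ≤ b → cut u.toFuzzySet b ⊆ cutUnion U a := fun b hb =>
        (cut_anti _ hb).trans (Set.subset_biUnion_of_mem (u := fun u => cut u.toFuzzySet a) hu)
      exact Set.union_subset (hsub _ ha.le) (hsub _ (by linarith))
    exact (fuzzyEDist_discretize_le hp.out u.toFuzzySet hN).trans_lt
      (ENNReal.add_lt_add_of_lt_of_le (ne_top_of_le_ne_top ENNReal.ofReal_ne_top hle)
        (hδU u hu _ (by positivity) hNδ) hle)
  let B := cutUnion U (1 / N)
  have hB : TotallyBounded B :=
    (hU.isBounded_cutUnion ha hbd (by positivity)).isCompact_closure.totallyBounded.subset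
      subset_closure
  obtain ⟨t, ht, hBt⟩ := EMetric.totallyBounded_iff.1
    (TopologicalSpace.NonemptyCompacts.totallyBounded_subsets_of_totallyBounded hB) (e / 2)
    (ENNReal.half_pos he.ne')
  let lev : Fin N → Set.Ioc (0 : ℝ) 1 := fun i => ⟨(i + 1) / N, by positivity, by
    rw [div_le_one hN']
    exact_mod_cast i.2⟩
  have hex : ∀ (u : U) (i : Fin N), ∃ K : t, edist (u.1.isUSCG1.cutCompact (lev i)) K < e / 2 := by
    intro u i
    have hsub : (u.1.isUSCG1.cutCompact (lev i) : Set X) ⊆ B := by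
      refine (cut_anti u.1.toFuzzySet ?_).trans (Set.subset_biUnion_of_mem
        (u := fun u => cut u.toFuzzySet (1 / N)) u.2)
      change (1 / N : ℝ) ≤ (i + 1) / N
      gcongr
      linarith [(i : ℕ).cast_nonneg (α := ℝ)]
    obtain ⟨K, hK, hKu⟩ := Set.mem_iUnion₂.1 (hBt hsub)
    exact ⟨⟨K, hK⟩, hKu⟩
  choose F hF using hex
  have := ht.fintype
  -- Each `u` is coded by the net points near its `N` cuts. Equal codes force these cuts to be
  -- within `e`, hence the radius `e / 2`.
  refine ⟨Fin N → t, inferInstance, F, fun u v huv => ?_⟩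
  have hmid : fuzzyEDist p (discretize N u.1.toFuzzySet) (discretize N v.1.toFuzzySet) ≤ e := by
    refine fuzzyEDist_discretize_discretize_le hp.out _ _ hN fun i => ?_
    have hv := hF v i
    rw [← huv, edist_comm] at hv
    exact ((edist_triangle (u.1.isUSCG1.cutCompact (lev i)) (F u i)
      (v.1.isUSCG1.cutCompact (lev i))).trans (add_le_add (hF u i).le hv.le)).trans
      (ENNReal.add_halves e).le
  have hlt : edist u.1 v.1 < ENNReal.ofReal ε := by
    have hv := happ v v.2
    rw [fuzzyEDist_comm] at hv
    have hu' := u.1.isUSCG1.discretize hN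
    have hv' := v.1.isUSCG1.discretize hN
    calc edist u.1 v.1 ≤ fuzzyEDist p u.1.toFuzzySet (discretize N u.1.toFuzzySet) +
          fuzzyEDist p (discretize N u.1.toFuzzySet) v.1.toFuzzySet :=
          fuzzyEDist_triangle hp.out u.1.isUSCG1 hu' v.1.isUSCG1
      _ ≤ fuzzyEDist p u.1.toFuzzySet (discretize N u.1.toFuzzySet) +
          (e + fuzzyEDist p (discretize N v.1.toFuzzySet) v.1.toFuzzySet) :=
          add_le_add_right ((fuzzyEDist_triangle hp.out hu' hv' v.1.isUSCG1).trans
            (add_le_add_left hmid _)) _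
      _ < (e + e) + (e + (e + e)) :=
          ENNReal.add_lt_add (happ u u.2)
            ((ENNReal.add_lt_add_iff_left ENNReal.ofReal_ne_top).2 hv)
      _ = ENNReal.ofReal ε := by
          simp only [e]
          rw [← ENNReal.ofReal_add (by positivity) (by positivity),
            ← ENNReal.ofReal_add (by positivity) (by positivity),
            ← ENNReal.ofReal_add (by positivity) (by positivity)]
          congr 1
          ring
  rw [edist_dist] at hlt
  exact (ENNReal.ofReal_lt_ofReal_iff hε).1 hlt

theorem totallyBounded_iff [ProperSpace X] [Fact (1 ≤ p)] {U : Set (FuzzyUSCGp X p)} :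
    TotallyBounded U ↔ (∃ h ∈ Set.Ioo (0 : ℝ) 1, Bornology.IsBounded (cutUnion U h)) ∧
      IsPMeanEquiLeftContinuous U :=
  ⟨fun h => ⟨⟨1 / 2, by norm_num, isBounded_cutUnion h.isBounded (by norm_num)⟩,
    h.isPMeanEquiLeftContinuous⟩, fun ⟨⟨_, ha, hb⟩, h⟩ => h.totallyBounded ha.2 hb⟩

end TotallyBounded

end Fuzzy

end

/-! ### From total boundedness to compactness -/

theorem theorem6p9 (m : ℕ) (p : ℝ) [Fact (1 ≤ p)]
    (U : Set (Fuzzy.FuzzyUSCGp (EuclideanSpace ℝ (Fin m)) p)) :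
    (IsCompact (closure U) ↔
      (∃ h ∈ Set.Ioo (0 : ℝ) 1, Bornology.IsBounded (Fuzzy.cutUnion U h)) ∧
        Fuzzy.IsPMeanEquiLeftContinuous U) ∧
    (TotallyBounded U ↔
      (∃ h ∈ Set.Ioo (0 : ℝ) 1, Bornology.IsBounded (Fuzzy.cutUnion U h)) ∧
        Fuzzy.IsPMeanEquiLeftContinuous U) ∧
    (IsCompact U ↔
      (∃ h ∈ Set.Ioo (0 : ℝ) 1, Bornology.IsBounded (Fuzzy.cutUnion U h)) ∧
        Fuzzy.IsPMeanEquiLeftContinuous U ∧ IsClosed U) := by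
  have : CompleteSpace (Fuzzy.FuzzyUSCGp (EuclideanSpace ℝ (Fin m)) p) :=
    Fuzzy.completeSpace_fuzzyUSCGp
  refine ⟨?_, Fuzzy.totallyBounded_iff, ?_⟩
  · rw [← Fuzzy.totallyBounded_iff]
    exact ⟨fun h => h.totallyBounded.subset subset_closure,
      fun h => h.closure.isCompact_of_isClosed isClosed_closure⟩
  · rw [← and_assoc, ← Fuzzy.totallyBounded_iff]
    exact ⟨fun h => ⟨h.totallyBounded, h.isClosed⟩,
      fun h => h.1.isCompact_of_isClosed h.2⟩
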